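/- Let $G$ be a totally disconnected, locally compact (topological) group and let $\operatorname{End}(G)$ be the semigroup, under composition, of continuous homomorphisms $\alpha\colon G\to G$. For $\alpha\in\operatorname{End}(G)$ define the scale of $\alpha$ by $$s(\alpha)=\min\{[\alpha(U):\alpha(U)\cap U] \mid U\le G \text{ a compact open subgroup}\}.$$ Then $s(\alpha)$ is a well-defined positive integer (compact open subgroups exist and all these indices are finite), so that $s\colon \operatorname{End}(G)\to\mathbb{Z}^+$, and for every $\alpha\in\operatorname{End}(G)$: - **S1.** $s(\alpha)=1$ if and only if there is a compact open subgroup $U\le G$ with $\alpha(U)\le U$; - **S2.** $s(\alpha^n)=s(\alpha)^n$ for every $n\in\mathbb{N}=\{0,1,2,\dots\}$. -/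

import Mathlib

/-- The semigroup `End(G)` of continuous endomorphisms of a topological group `G`. Multiplication is
composition, so `α ^ n` is the `n`-fold iterate of `α`. -/
def ContEnd (G : Type*) [Group G] [TopologicalSpace G] : Submonoid (Monoid.End G) where
  carrier := {f | Continuous f}
  one_mem' := continuous_id
  mul_mem' := fun {f g} (hf : Continuous f) (hg : Continuous g) => by
    simpa [Monoid.End.coe_mul] using hf.comp hg

/-- `α(U)`, the image of the subgroup `U` under the endomorphism `α`. -/
def imageSubgroup {G : Type*} [Group G] [TopologicalSpace G] (α : ContEnd G) (U : Subgroup G) :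
    Subgroup G :=
  Subgroup.map (α : Monoid.End G) U

/-- The displacement index `[α(U) : α(U) ∩ U]`. (Mathlib's index is `0` when it is infinite.) -/
noncomputable def displacementIndex {G : Type*} [Group G] [TopologicalSpace G] (α : ContEnd G)
    (U : Subgroup G) : ℕ :=
  (imageSubgroup α U ⊓ U).relIndex (imageSubgroup α U)

/-- The scale `s(α)`, the minimum of the displacement indices of the compact open subgroups of `G`.
It is `0` exactly when there are no compact open subgroups or some displacement index is infinite;
hence `0 < scale α` says that the set is a nonempty set of finite indices, and then the infimum is
an attained minimum. -/
noncomputable def scale {G : Type*} [Group G] [TopologicalSpace G] (α : ContEnd G) : ℕ :=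
  sInf {m : ℕ | ∃ U : Subgroup G,
    IsCompact (U : Set G) ∧ IsOpen (U : Set G) ∧ m = displacementIndex α U}

/-! The scale is a growth rate: for a suitable compact open `V`, the indices `[f^n(V) : f^n(V) ∩ V]`
lie between `s(f)^n` and a constant times `s(f)^n`. Changing `V` costs only a constant factor
(`relIndex_endMap_le`). The upper bound is submultiplicativity (`relIndex_endMap_mul_le`), applied
to a minimizing subgroup. Comparing growth rates then gives S2; S1 and positivity follow because the
minimum is attained and finite.

The lower bound is `exists_forall_pow_le_relIndex`. For compact open `M`, every factor of `[M : stay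
f M n]` is a displacement index, so this index is at least `s^n`. It must be compared with `[V : V ∩
f^{-n}(V)]`, which ignores intermediate times. If `V` is tidy above, a trajectory starting and
ending in `V` stays in `V` up to a homoclinic correction. The closure `L` of the homoclinic group is
compact and `f`-invariant. Taking `V` normalized by `L` and `M = LV` absorbs the correction, so `V ∩
f^{-n}(V) ≤ stay f M n`. -/

namespace EndScale

/-! ### Trajectories inside a subgroup and their indices -/

section Algebra

variable {G : Type*} [Group G]

theorem pow_succ_apply (f : Monoid.End G) (n : ℕ) (x : G) : (f ^ (n + 1)) x = f ((f ^ n) x) := by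
  rw [pow_succ', Monoid.End.coe_mul, Function.comp_apply]

theorem pow_succ_apply' (f : Monoid.End G) (n : ℕ) (x : G) : (f ^ (n + 1)) x = (f ^ n) (f x) := by
  rw [pow_succ, Monoid.End.coe_mul, Function.comp_apply]

theorem pow_add_apply (f : Monoid.End G) (m n : ℕ) (x : G) :
    (f ^ (m + n)) x = (f ^ m) ((f ^ n) x) := by
  rw [pow_add, Monoid.End.coe_mul, Function.comp_apply]

/-- The image of a subgroup under an endomorphism. -/
def endMap (f : Monoid.End G) (U : Subgroup G) : Subgroup G :=
  Subgroup.map f U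

/-- The preimage of a subgroup under an endomorphism. -/
def endComap (f : Monoid.End G) (U : Subgroup G) : Subgroup G :=
  Subgroup.comap f U

theorem mem_endMap {f : Monoid.End G} {U : Subgroup G} {x : G} :
    x ∈ endMap f U ↔ ∃ y ∈ U, f y = x :=
  Iff.rfl

theorem mem_endComap {f : Monoid.End G} {U : Subgroup G} {x : G} : x ∈ endComap f U ↔ f x ∈ U :=
  Iff.rfl

theorem coe_endComap (f : Monoid.End G) (U : Subgroup G) : (endComap f U : Set G) = f ⁻¹' U :=
  rfl

theorem endMap_mono {f : Monoid.End G} {U V : Subgroup G} (h : U ≤ V) :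
    endMap f U ≤ endMap f V :=
  Subgroup.map_mono h

theorem endComap_mono {f : Monoid.End G} {U V : Subgroup G} (h : U ≤ V) :
    endComap f U ≤ endComap f V :=
  fun _ hx => h hx

theorem endMap_one (U : Subgroup G) : endMap 1 U = U :=
  Subgroup.map_id U

theorem endMap_mul (f g : Monoid.End G) (U : Subgroup G) :
    endMap (f * g) U = endMap f (endMap g U) :=
  (Subgroup.map_map U f g).symm

theorem relIndex_endComap (f : Monoid.End G) (U K : Subgroup G) :
    (endComap f U).relIndex K = U.relIndex (endMap f K) :=
  Subgroup.relIndex_comap U f K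

/-- The elements of `U` whose first `n` iterates under `f` also lie in `U`. -/
def stay (f : Monoid.End G) (U : Subgroup G) (n : ℕ) : Subgroup G :=
  ⨅ (k : ℕ) (_ : k ≤ n), endComap (f ^ k) U

/-- The elements all of whose iterates under `f` lie in `U`. -/
def stayForever (f : Monoid.End G) (U : Subgroup G) : Subgroup G :=
  ⨅ k : ℕ, endComap (f ^ k) U

/-- The end points of the `f`-trajectories of length `n` inside `U`. -/
def reach (f : Monoid.End G) (U : Subgroup G) (n : ℕ) : Subgroup G :=
  endMap (f ^ n) (stay f U n)

/-- The elements that are end points of arbitrarily long `f`-trajectories inside `U`. -/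
def backward (f : Monoid.End G) (U : Subgroup G) : Subgroup G :=
  ⨅ n : ℕ, reach f U n

/-- The subgroup of the elements which have an `f`-trajectory through them that
stays in `U` both in the remote past and in the remote future. -/
def homoclinic (f : Monoid.End G) (U : Subgroup G) : Subgroup G :=
  (⨆ n : ℕ, endMap (f ^ n) (backward f U)) ⊓
    ⨆ n : ℕ, endComap (f ^ n) (stayForever f U)

variable {f : Monoid.End G} {U V : Subgroup G} {n : ℕ} {x : G}

theorem mem_stay : x ∈ stay f U n ↔ ∀ k ≤ n, (f ^ k) x ∈ U := by
  simp only [stay, Subgroup.mem_iInf, mem_endComap]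

theorem mem_stayForever : x ∈ stayForever f U ↔ ∀ k, (f ^ k) x ∈ U := by
  simp only [stayForever, Subgroup.mem_iInf, mem_endComap]

theorem mem_reach : x ∈ reach f U n ↔ ∃ y ∈ stay f U n, (f ^ n) y = x := Iff.rfl

theorem mem_backward : x ∈ backward f U ↔ ∀ n, x ∈ reach f U n := by
  simp [backward, Subgroup.mem_iInf]

theorem stay_le : stay f U n ≤ U := fun _ hx => mem_stay.1 hx 0 (Nat.zero_le n)

theorem stay_zero : stay f U 0 = U :=
  le_antisymm stay_le fun x hx => mem_stay.2 fun k hk => by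
    obtain rfl : k = 0 := by omega
    exact hx

theorem stay_antitone : Antitone (stay f U) := fun _ _ h _ hx =>
  mem_stay.2 fun k hk => mem_stay.1 hx k (hk.trans h)

theorem stay_mono (h : V ≤ U) : stay f V n ≤ stay f U n := fun _ hx =>
  mem_stay.2 fun k hk => h (mem_stay.1 hx k hk)

theorem stayForever_le_stay : stayForever f U ≤ stay f U n := fun _ hx =>
  mem_stay.2 fun k _ => mem_stayForever.1 hx k

theorem stayForever_le : stayForever f U ≤ U := fun _ hx => mem_stayForever.1 hx 0

theorem mem_stay_succ_iff : x ∈ stay f U (n + 1) ↔ x ∈ U ∧ f x ∈ stay f U n := by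
  simp only [mem_stay]
  refine ⟨fun h => ⟨h 0 (by omega), fun k hk => ?_⟩, fun h k hk => ?_⟩
  · rw [← pow_succ_apply']; exact h (k + 1) (by omega)
  · cases k with
    | zero => exact h.1
    | succ k => rw [pow_succ_apply']; exact h.2 k (by omega)

theorem stay_succ : stay f U (n + 1) = stay f U n ⊓ endComap (f ^ (n + 1)) U := by
  ext x
  simp only [mem_stay, Subgroup.mem_inf, mem_endComap]
  refine ⟨fun h => ⟨fun k hk => h k (by omega), h _ le_rfl⟩, fun h k hk => ?_⟩
  rcases Nat.le_succ_iff.1 hk with hk | rfl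
  · exact h.1 k hk
  · exact h.2

theorem stay_succ' : stay f U (n + 1) = stay f U n ⊓ endComap f (stay f U n) := by
  ext x
  rw [mem_stay_succ_iff, Subgroup.mem_inf, mem_endComap]
  refine ⟨fun h => ⟨?_, h.2⟩, fun h => ⟨stay_le h.1, h.2⟩⟩
  exact stay_antitone (Nat.le_succ n) (mem_stay_succ_iff.2 h)

theorem stay_stay (m n : ℕ) : stay f (stay f U m) n = stay f U (m + n) := by
  ext x
  simp only [mem_stay]
  refine ⟨fun h k hk => ?_, fun h k hk j hj => ?_⟩
  · obtain ⟨i, j, hi, hj, rfl⟩ : ∃ i j, i ≤ m ∧ j ≤ n ∧ k = i + j :=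
      ⟨min k m, k - min k m, by omega, by omega, by omega⟩
    rw [pow_add_apply]; exact h j hj i hi
  · rw [← pow_add_apply]; exact h _ (by omega)

theorem reach_zero : reach f U 0 = U := by
  rw [reach, stay_zero, pow_zero, endMap_one]

theorem reach_succ : reach f U (n + 1) = endMap f (reach f U n) ⊓ U := by
  ext x
  simp only [Subgroup.mem_inf, mem_endMap, mem_reach]
  constructor
  · rintro ⟨y, hy, rfl⟩
    exact ⟨⟨_, ⟨y, stay_antitone (Nat.le_succ n) hy, rfl⟩, (pow_succ_apply f n y).symm⟩,
      mem_stay.1 hy _ le_rfl⟩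
  · rintro ⟨⟨_, ⟨y, hy, rfl⟩, rfl⟩, hx⟩
    refine ⟨y, ?_, pow_succ_apply f n y⟩
    rw [stay_succ]
    exact Subgroup.mem_inf.2 ⟨hy, by rwa [mem_endComap, pow_succ_apply]⟩

theorem reach_antitone : Antitone (reach f U) := by
  refine antitone_nat_of_succ_le fun n => ?_
  induction n with
  | zero => rw [reach_succ, reach_zero]; exact inf_le_right
  | succ n ih =>
    have h := inf_le_inf_right U (endMap_mono (f := f) ih)
    rwa [← reach_succ, ← reach_succ] at h

theorem backward_le : backward f U ≤ U := fun _ hx => by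
  simpa [reach_zero] using mem_backward.1 hx 0

theorem map_backward_inf_le : endMap f (backward f U) ⊓ U ≤ backward f U := by
  rintro _ ⟨⟨y, hy, rfl⟩, hx⟩
  refine mem_backward.2 fun n => reach_antitone (Nat.le_succ n) ?_
  rw [reach_succ]
  exact ⟨⟨y, mem_backward.1 hy n, rfl⟩, hx⟩

theorem backward_mono (h : V ≤ U) : backward f V ≤ backward f U :=
  iInf_mono fun _ => endMap_mono (stay_mono h)

theorem stayForever_mono (h : V ≤ U) : stayForever f V ≤ stayForever f U :=
  iInf_mono fun _ => endComap_mono h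

theorem homoclinic_mono (h : V ≤ U) : homoclinic f V ≤ homoclinic f U :=
  inf_le_inf (iSup_mono fun _ => endMap_mono (backward_mono h))
    (iSup_mono fun _ => endComap_mono (stayForever_mono h))

theorem apply_mem_stayForever (hx : x ∈ stayForever f U) : f x ∈ stayForever f U :=
  mem_stayForever.2 fun k => by rw [← pow_succ_apply']; exact mem_stayForever.1 hx (k + 1)

theorem monotone_comap_stayForever :
    Monotone fun n : ℕ => endComap (f ^ n) (stayForever f U) :=
  monotone_nat_of_le_succ fun n x hx => by
    rw [mem_endComap, pow_succ_apply]
    exact apply_mem_stayForever hx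

theorem mem_iSup_comap_stayForever :
    x ∈ (⨆ n : ℕ, endComap (f ^ n) (stayForever f U)) ↔ ∃ n, (f ^ n) x ∈ stayForever f U :=
  Subgroup.mem_iSup_of_directed monotone_comap_stayForever.directed_le

theorem mem_homoclinic_of_backward (hx : x ∈ backward f U) (h : (f ^ n) x ∈ stayForever f U) :
    x ∈ homoclinic f U :=
  ⟨Subgroup.mem_iSup_of_mem 0 ⟨x, hx, rfl⟩, mem_iSup_comap_stayForever.2 ⟨n, h⟩⟩

theorem monotone_map_pow_backward (h : backward f U ≤ endMap f (backward f U)) :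
    Monotone fun n : ℕ => endMap (f ^ n) (backward f U) := by
  refine monotone_nat_of_le_succ fun n => ?_
  rintro _ ⟨x, hx, rfl⟩
  obtain ⟨y, hy, rfl⟩ := h hx
  exact ⟨y, hy, pow_succ_apply' f n y⟩

theorem mem_homoclinic (h : backward f U ≤ endMap f (backward f U)) :
    x ∈ homoclinic f U ↔
      (∃ n, ∃ y ∈ backward f U, (f ^ n) y = x) ∧ ∃ n, (f ^ n) x ∈ stayForever f U :=
  and_congr (Subgroup.mem_iSup_of_directed (monotone_map_pow_backward h).directed_le)
    mem_iSup_comap_stayForever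

theorem map_homoclinic_le (h : backward f U ≤ endMap f (backward f U)) :
    endMap f (homoclinic f U) ≤ homoclinic f U := by
  rintro _ ⟨x, hx, rfl⟩
  obtain ⟨⟨m, y, hy, rfl⟩, n, hn⟩ := (mem_homoclinic h).1 hx
  refine (mem_homoclinic h).2 ⟨⟨m + 1, y, hy, pow_succ_apply f m y⟩, n, ?_⟩
  have := apply_mem_stayForever hn
  rw [← pow_succ_apply, pow_succ_apply'] at this
  exact this

/-- Choosing preimages within `backward f U` keeps the whole past trajectory in `U`. -/
theorem exists_mem_backward_stay (h : backward f U ≤ endMap f (backward f U)) (n : ℕ)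
    (hx : x ∈ backward f U) : ∃ w ∈ backward f U, w ∈ stay f U n ∧ (f ^ n) w = x := by
  induction n generalizing x with
  | zero => exact ⟨x, hx, by rw [stay_zero]; exact backward_le hx, rfl⟩
  | succ n ih =>
    obtain ⟨y, hy, hyn, rfl⟩ := ih hx
    obtain ⟨w, hw, rfl⟩ := h hy
    exact ⟨w, hw, mem_stay_succ_iff.2 ⟨backward_le hw, hyn⟩, pow_succ_apply' f n w⟩

/-- Since `reach f U n` decreases with `n`, this form shows that the successive indices decrease. -/
theorem relIndex_stay_succ :
    (stay f U (n + 1)).relIndex (stay f U n) = U.relIndex (endMap f (reach f U n)) := by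
  rw [stay_succ, Subgroup.inf_relIndex_left, relIndex_endComap, reach, ← endMap_mul,
    pow_succ']

/-- In this form the successive index is the displacement index of `stay f U n`, hence bounded below
by the scale. -/
theorem relIndex_stay_succ' : (stay f U (n + 1)).relIndex (stay f U n) =
    (stay f U n).relIndex (endMap f (stay f U n)) := by
  rw [stay_succ', Subgroup.inf_relIndex_left, relIndex_endComap]

theorem pow_le_relIndex_stay {s : ℕ}
    (h : ∀ n, s ≤ (stay f U n).relIndex (endMap f (stay f U n))) (n : ℕ) :
    s ^ n ≤ (stay f U n).relIndex U := by
  induction n with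
  | zero => simp [stay_zero]
  | succ n ih =>
    rw [← Subgroup.relIndex_mul_relIndex _ _ _ (stay_antitone (Nat.le_succ n)) stay_le, pow_succ',
      relIndex_stay_succ']
    exact Nat.mul_le_mul (h n) ih

theorem relIndex_endMap_endMap_le {g : Monoid.End G} {H K : Subgroup G} (h : H.relIndex K ≠ 0) :
    (endMap g H).relIndex (endMap g K) ≤ H.relIndex K := by
  rw [← relIndex_endComap]
  exact Subgroup.relIndex_le_of_le_left (fun x hx => mem_endComap.2 (mem_endMap.2 ⟨x, hx, rfl⟩)) h

/-- The cosets in `A` inject into those in `B`; equal finite cardinality makes this surjective. -/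
theorem exists_inv_mul_mem_of_relIndex_eq {A B : Subgroup G} (hAB : A ≤ B)
    (h0 : U.relIndex B ≠ 0) (h : U.relIndex A = U.relIndex B) {b : G} (hb : b ∈ B) :
    ∃ a ∈ A, a⁻¹ * b ∈ U := by
  have : Finite (B ⧸ U.subgroupOf B) := Nat.finite_of_card_ne_zero h0
  have hbij := (Nat.bijective_iff_injective_and_card
    (Subgroup.quotientSubgroupOfEmbeddingOfLE U hAB)).2
      ⟨(Subgroup.quotientSubgroupOfEmbeddingOfLE U hAB).injective, h⟩
  obtain ⟨q, hq⟩ := hbij.2 (QuotientGroup.mk ⟨b, hb⟩)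
  induction q using QuotientGroup.induction_on with
  | H a =>
    refine ⟨a, a.2, ?_⟩
    rw [Subgroup.quotientSubgroupOfEmbeddingOfLE_apply_mk, QuotientGroup.eq] at hq
    exact hq

theorem relIndex_le_of_forall_exists {A B : Subgroup G} (hAB : A ≤ B) (h0 : U.relIndex A ≠ 0)
    (h : ∀ b ∈ B, ∃ a ∈ A, a⁻¹ * b ∈ U) : U.relIndex B ≤ U.relIndex A := by
  have : Finite (A ⧸ U.subgroupOf A) := Nat.finite_of_card_ne_zero h0
  refine Nat.card_le_card_of_surjective (Subgroup.quotientSubgroupOfEmbeddingOfLE U hAB) ?_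
  intro q
  induction q using QuotientGroup.induction_on with
  | H b =>
    obtain ⟨a, ha, hab⟩ := h b b.2
    refine ⟨QuotientGroup.mk ⟨a, ha⟩, ?_⟩
    rw [Subgroup.quotientSubgroupOfEmbeddingOfLE_apply_mk, QuotientGroup.eq]
    exact hab

end Algebra

/-! ### Compact open subgroups -/

section Topology

open Topology Pointwise

variable {G : Type*} [Group G] [TopologicalSpace G]

theorem continuous_pow {f : Monoid.End G} (hf : Continuous f) (n : ℕ) : Continuous (f ^ n) := by
  rw [Monoid.End.coe_pow]
  exact hf.iterate n

theorem isCompact_endMap {f : Monoid.End G} (hf : Continuous f) {U : Subgroup G}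
    (hU : IsCompact (U : Set G)) : IsCompact (endMap f U : Set G) :=
  hU.image hf

theorem isOpen_stay {f : Monoid.End G} (hf : Continuous f) {U : Subgroup G}
    (hU : IsOpen (U : Set G)) (n : ℕ) : IsOpen (stay f U n : Set G) := by
  induction n with
  | zero => rwa [stay_zero]
  | succ n ih =>
    rw [stay_succ, Subgroup.coe_inf, coe_endComap]
    exact ih.inter (hU.preimage (continuous_pow hf _))

variable [IsTopologicalGroup G]

theorem relIndex_ne_zero_of_isOpen_of_isCompact {U K : Subgroup G} (hU : IsOpen (U : Set G))
    (hK : IsCompact (K : Set G)) : U.relIndex K ≠ 0 := by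
  have : CompactSpace K := isCompact_iff_compactSpace.1 hK
  have : Finite (K ⧸ U.subgroupOf K) :=
    (U.subgroupOf K).quotient_finite_of_isOpen (hU.preimage continuous_subtype_val)
  exact Nat.card_pos.ne'

/-- A totally disconnected locally compact group has a compact open subgroup. -/
theorem exists_isCompact_isOpen_subgroup [LocallyCompactSpace G] [TotallyDisconnectedSpace G] :
    ∃ U : Subgroup G, IsCompact (U : Set G) ∧ IsOpen (U : Set G) := by
  obtain ⟨K, hK, hK1⟩ := exists_compact_mem_nhds (1 : G)
  obtain ⟨W, hW, hW1, hWK⟩ := (loc_compact_Haus_tot_disc_of_zero_dim (H := G)).mem_nhds_iff.1 hK1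
  have hWc : IsCompact W := hK.of_isClosed_subset hW.1 hWK
  -- The stabilizer of the compact open set `W` under left translation; it lies in `W` because `1 ∈
  -- W`.
  let U : Subgroup G :=
    { carrier := {g | (∀ w ∈ W, g * w ∈ W) ∧ ∀ w ∈ W, g⁻¹ * w ∈ W}
      mul_mem' := fun {a b} ha hb =>
        ⟨fun w hw => by rw [mul_assoc]; exact ha.1 _ (hb.1 w hw),
          fun w hw => by rw [mul_inv_rev, mul_assoc]; exact hb.2 _ (ha.2 w hw)⟩
      one_mem' := by simp
      inv_mem' := fun {a} ha => ⟨ha.2, by simpa using ha.1⟩ }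
  have hUo : IsOpen (U : Set G) := by
    refine Subgroup.isOpen_of_mem_nhds U (g := 1) ?_
    have h : ∀ᶠ g in 𝓝 (1 : G), ∀ w ∈ W, g * w ∈ W :=
      hWc.eventually_forall_of_forall_eventually fun w hw =>
        (continuous_mul (M := G)).continuousAt.eventually (hW.2.mem_nhds (by simpa using hw))
    have h' : ∀ᶠ g in 𝓝 (1 : G), ∀ w ∈ W, g⁻¹ * w ∈ W := by
      have := (continuous_inv (G := G)).continuousAt (x := 1)
      rw [ContinuousAt, inv_one] at this
      exact this.eventually h
    filter_upwards [h, h'] with g hg hg' using ⟨hg, hg'⟩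
  refine ⟨U, hWc.of_isClosed_subset (U.isClosed_of_isOpen hUo) fun g hg => ?_, hUo⟩
  simpa using hg.1 1 hW1

/-- If `L` is a compact subgroup, then every open subgroup `U` contains an open subgroup that is
normalized by `L`. -/
theorem exists_isOpen_le_forall_conj_mem {U L : Subgroup G} (hU : IsOpen (U : Set G))
    (hL : IsCompact (L : Set G)) :
    ∃ V ≤ U, IsOpen (V : Set G) ∧ ∀ l ∈ L, ∀ x ∈ V, l * x * l⁻¹ ∈ V := by
  let V : Subgroup G := ⨅ l : L, Subgroup.comap (MulAut.conj (l : G)).toMonoidHom U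
  have hV : ∀ x, x ∈ V ↔ ∀ l ∈ L, l * x * l⁻¹ ∈ U := fun x => by
    simp [V, Subgroup.mem_iInf, Subgroup.mem_comap]
  refine ⟨V, fun x hx => by simpa using (hV x).1 hx 1 L.one_mem, ?_, fun l hl x hx => ?_⟩
  · refine V.isOpen_of_mem_nhds (g := 1) ?_
    have h : ∀ᶠ x in 𝓝 (1 : G), ∀ l ∈ (L : Set G), l * x * l⁻¹ ∈ U := by
      refine hL.eventually_forall_of_forall_eventually fun l _ => ?_
      have hc : Continuous fun p : G × G => p.2 * p.1 * p.2⁻¹ := by fun_prop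
      exact hc.continuousAt.eventually (hU.mem_nhds (by simp))
    filter_upwards [h] with x hx using (hV x).2 hx
  · refine (hV _).2 fun m hm => ?_
    have := (hV x).1 hx (m * l) (L.mul_mem hm hl)
    simpa [mul_assoc] using this

/-! ### Tidiness above -/

variable {f : Monoid.End G} {U : Subgroup G}

theorem isCompact_of_le {V : Subgroup G} (hU : IsCompact (U : Set G)) (h : V ≤ U)
    (hV : IsOpen (V : Set G)) : IsCompact (V : Set G) :=
  hU.of_isClosed_subset (V.isClosed_of_isOpen hV) h

theorem isCompact_stay (hf : Continuous f) (hUc : IsCompact (U : Set G))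
    (hU : IsOpen (U : Set G)) (n : ℕ) : IsCompact (stay f U n : Set G) :=
  isCompact_of_le hUc stay_le (isOpen_stay hf hU n)

theorem isCompact_reach (hf : Continuous f) (hUc : IsCompact (U : Set G))
    (hU : IsOpen (U : Set G)) (n : ℕ) : IsCompact (reach f U n : Set G) :=
  isCompact_endMap (continuous_pow hf n) (isCompact_stay hf hUc hU n)

/-- The property of being tidy above: the indices `[U_n : U_{n+1}]` for `U_n = stay f U n` do not
depend on `n`. -/
def TidyAbove (f : Monoid.End G) (U : Subgroup G) : Prop :=
  ∀ n, U.relIndex (endMap f (reach f U n)) = U.relIndex (endMap f U)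

/-- The successive indices form a decreasing sequence of naturals, so they stabilize at some `N`;
replacing `U` by `stay f U N` shifts the sequence by `N`. -/
theorem exists_tidyAbove_stay (hf : Continuous f) (hUc : IsCompact (U : Set G))
    (hU : IsOpen (U : Set G)) : ∃ N, TidyAbove f (stay f U N) := by
  let e : ℕ → ℕ := fun n => U.relIndex (endMap f (reach f U n))
  have he : Antitone e := fun m n hmn =>
    Subgroup.relIndex_le_of_le_right (endMap_mono (reach_antitone hmn))
      (relIndex_ne_zero_of_isOpen_of_isCompact hU
        (isCompact_endMap hf (isCompact_reach hf hUc hU m)))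
  obtain ⟨N, hN⟩ := WellFoundedLT.antitone_chain_condition he
  have key : ∀ n, (stay f U N).relIndex (endMap f (reach f (stay f U N) n)) = e N := fun n => by
    rw [← relIndex_stay_succ, stay_stay, stay_stay, ← add_assoc, relIndex_stay_succ]
    exact (hN _ (Nat.le_add_right N n)).symm
  refine ⟨N, fun n => ?_⟩
  have h0 := key 0
  rw [reach_zero] at h0
  rw [key, h0]

/-! ### Factorizations and the homoclinic group -/

variable [T2Space G]

theorem isClosed_backward (hf : Continuous f) (hUc : IsCompact (U : Set G))
    (hU : IsOpen (U : Set G)) : IsClosed (backward f U : Set G) := by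
  rw [backward, Subgroup.coe_iInf]
  exact isClosed_iInter fun n => (isCompact_reach hf hUc hU n).isClosed

theorem isCompact_backward (hf : Continuous f) (hUc : IsCompact (U : Set G))
    (hU : IsOpen (U : Set G)) : IsCompact (backward f U : Set G) :=
  hUc.of_isClosed_subset (isClosed_backward hf hUc hU) backward_le

theorem exists_mem_backward_of_forall_reach (hf : Continuous f) (hUc : IsCompact (U : Set G))
    (hU : IsOpen (U : Set G)) {C : Set G} (hC : IsClosed C) (h : ∀ n, ∃ y ∈ reach f U n, y ∈ C) :
    ∃ y ∈ backward f U, y ∈ C := by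
  obtain ⟨y, hy⟩ := IsCompact.nonempty_iInter_of_sequence_nonempty_isCompact_isClosed
    (fun n => (reach f U n : Set G) ∩ C)
    (fun n => Set.inter_subset_inter_left _ (reach_antitone (Nat.le_succ n))) h
    ((isCompact_reach hf hUc hU 0).inter_right hC)
    (fun n => (isCompact_reach hf hUc hU n).isClosed.inter hC)
  rw [Set.mem_iInter] at hy
  exact ⟨y, mem_backward.2 fun n => (hy n).1, (hy 0).2⟩

theorem backward_le_endMap (hf : Continuous f) (hUc : IsCompact (U : Set G))
    (hU : IsOpen (U : Set G)) : backward f U ≤ endMap f (backward f U) := by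
  intro x hx
  refine mem_endMap.2 (exists_mem_backward_of_forall_reach hf hUc hU (C := f ⁻¹' {x})
    (isClosed_singleton.preimage hf) fun n => ?_)
  have h := mem_backward.1 hx (n + 1)
  rw [reach_succ] at h
  exact mem_endMap.1 h.1

/-- Tidiness says that `f(reach f U n)` meets every coset of `U` that `f(U)` meets. By compactness
so does `f(backward f U)`, which corrects `x` for one step; the correction for later steps is pulled
back along `f`. -/
theorem TidyAbove.exists_backward_mul_stay (hf : Continuous f) (hUc : IsCompact (U : Set G))
    (hU : IsOpen (U : Set G)) (ht : TidyAbove f U) (n : ℕ) {x : G} (hx : x ∈ U) :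
    ∃ w ∈ backward f U, w⁻¹ * x ∈ stay f U n := by
  induction n generalizing x with
  | zero => exact ⟨1, one_mem _, by simpa [stay_zero] using hx⟩
  | succ n ih =>
    have h1 : ∃ w ∈ backward f U, w⁻¹ * x ∈ endComap f U := by
      refine exists_mem_backward_of_forall_reach hf hUc hU
        (C := (fun w => f (w⁻¹ * x)) ⁻¹' (U : Set G)) ?_ fun n => ?_
      · exact (U.isClosed_of_isOpen hU).preimage (by fun_prop)
      · obtain ⟨y, hy, h⟩ := exists_inv_mul_mem_of_relIndex_eq
          (endMap_mono (reach_antitone (Nat.zero_le n)))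
          (relIndex_ne_zero_of_isOpen_of_isCompact hU
            (isCompact_endMap hf (isCompact_reach hf hUc hU 0)))
          (by rw [ht n, reach_zero]) (mem_endMap.2 ⟨x, by rwa [reach_zero], rfl⟩)
        obtain ⟨w, hw, rfl⟩ := mem_endMap.1 hy
        exact ⟨w, hw, by simpa using h⟩
    obtain ⟨w, hw, hwx⟩ := h1
    obtain ⟨v, hv, hvx⟩ := ih (mem_endComap.1 hwx)
    obtain ⟨u, hu, rfl⟩ := backward_le_endMap hf hUc hU hv
    refine ⟨w * u, mul_mem hw hu, mem_stay_succ_iff.2 ⟨?_, ?_⟩⟩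
    · exact mul_mem (inv_mem (mul_mem (backward_le hw) (backward_le hu))) hx
    · have : f ((w * u)⁻¹ * x) = (f u)⁻¹ * f (w⁻¹ * x) := by simp [mul_assoc]
      rw [this]
      exact hvx

theorem TidyAbove.exists_backward_mul_stayForever (hf : Continuous f)
    (hUc : IsCompact (U : Set G)) (hU : IsOpen (U : Set G)) (ht : TidyAbove f U) {x : G}
    (hx : x ∈ U) : ∃ w ∈ backward f U, w⁻¹ * x ∈ stayForever f U := by
  have hcl : ∀ n, IsClosed ((backward f U : Set G) ∩ (fun w => w⁻¹ * x) ⁻¹' (stay f U n)) :=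
    fun n => (isClosed_backward hf hUc hU).inter
      (((stay f U n).isClosed_of_isOpen (isOpen_stay hf hU n)).preimage (by fun_prop))
  obtain ⟨w, hw⟩ := IsCompact.nonempty_iInter_of_sequence_nonempty_isCompact_isClosed
    (fun n => (backward f U : Set G) ∩ (fun w => w⁻¹ * x) ⁻¹' (stay f U n))
    (fun n => Set.inter_subset_inter_right _ (Set.preimage_mono (stay_antitone (Nat.le_succ n))))
    (fun n => ht.exists_backward_mul_stay hf hUc hU n hx)
    ((isCompact_backward hf hUc hU).of_isClosed_subset (hcl 0) Set.inter_subset_left) hcl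
  rw [Set.mem_iInter] at hw
  exact ⟨w, (hw 0).1, mem_stayForever.2 fun k => mem_stay.1 (hw k).2 k le_rfl⟩

/-- Up to homoclinic elements, a trajectory that starts and ends in `U` stays in `U` throughout. -/
theorem TidyAbove.exists_homoclinic_mul_inv_mem_stay (hf : Continuous f)
    (hUc : IsCompact (U : Set G)) (hU : IsOpen (U : Set G)) (ht : TidyAbove f U) {n : ℕ} {x : G}
    (hx : x ∈ U) (hxn : (f ^ n) x ∈ U) : ∃ l ∈ homoclinic f U, x * l⁻¹ ∈ stay f U n := by
  -- Write `x⁻¹ = u * a` and `f^n(u⁻¹) = v * b` with `a`, `b` in `stayForever f U`, and pull `v`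
  -- back to `w` inside `U`. Then `l = w⁻¹ * u⁻¹` has `f^n(l) = b` and `x * l⁻¹ = a⁻¹ * w`.
  obtain ⟨u, hu, hux⟩ := ht.exists_backward_mul_stayForever hf hUc hU (inv_mem hx)
  have hun : (f ^ n) u⁻¹ ∈ U := by
    have h1 := mul_mem (mem_stayForever.1 hux n) hxn
    rwa [← map_mul, inv_mul_cancel_right] at h1
  obtain ⟨v, hv, hvu⟩ := ht.exists_backward_mul_stayForever hf hUc hU hun
  obtain ⟨w, hw, hwn, rfl⟩ := exists_mem_backward_stay (backward_le_endMap hf hUc hU) n hv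
  refine ⟨w⁻¹ * u⁻¹, mem_homoclinic_of_backward (n := n)
    (mul_mem (inv_mem hw) (inv_mem hu)) (by simpa using hvu), ?_⟩
  have : x * (w⁻¹ * u⁻¹)⁻¹ = (u⁻¹ * x⁻¹)⁻¹ * w := by group
  rw [this]
  exact mul_mem (inv_mem (stayForever_le_stay hux)) hwn

/-- Confines the homoclinic group to the compact set `U * f^N(U)`. Finitely many coset
representatives suffice to bring `f(Q)` back into `Q`, and a single `N` bounds the times after which
they stay in `U`. -/
theorem exists_homoclinic_subset (hf : Continuous f) (hUc : IsCompact (U : Set G))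
    (hU : IsOpen (U : Set G)) :
    ∃ N, ∀ x ∈ homoclinic f U, ∃ v ∈ U, ∃ y ∈ U, x = v * (f ^ N) y := by
  have hb := backward_le_endMap hf hUc hU
  let Q : Subgroup G := backward f U ⊓ ⨆ n : ℕ, endComap (f ^ n) (stayForever f U)
  have hQ : ∀ x, x ∈ Q ↔ x ∈ backward f U ∧ ∃ n, (f ^ n) x ∈ stayForever f U := fun x =>
    and_congr_right fun _ => mem_iSup_comap_stayForever
  have hfQ : Q ≤ endMap f Q := fun x hx => by
    obtain ⟨hx, n, hn⟩ := (hQ x).1 hx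
    obtain ⟨y, hy, rfl⟩ := hb hx
    exact ⟨y, (hQ y).2 ⟨hy, n + 1, by rwa [pow_succ_apply']⟩, rfl⟩
  have hfin : Finite (endMap f Q ⧸ U.subgroupOf (endMap f Q)) := by
    refine Nat.finite_of_card_ne_zero fun h0 => ?_
    exact relIndex_ne_zero_of_isOpen_of_isCompact hU
      (isCompact_endMap hf (isCompact_backward hf hUc hU))
      (Subgroup.relIndex_eq_zero_of_le_right (endMap_mono inf_le_left) h0)
  have hex : ∀ q : endMap f Q ⧸ U.subgroupOf (endMap f Q), ∃ n,
      (f ^ n) (q.out : G) ∈ stayForever f U := fun q => by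
    obtain ⟨y, hy, hyq⟩ := q.out.2
    obtain ⟨_, n, hn⟩ := (hQ y).1 hy
    refine ⟨n, ?_⟩
    rw [← hyq]
    have h := apply_mem_stayForever hn
    rw [← pow_succ_apply, pow_succ_apply'] at h
    exact h
  choose g hg using hex
  obtain ⟨N, hN⟩ := (Set.finite_range g).bddAbove
  have hstep : ∀ n ≥ N, ∀ y ∈ Q, ∃ v ∈ stayForever f U, ∃ z ∈ Q,
      (f ^ (n + 1)) y = v * (f ^ n) z := by
    intro n hn y hy
    have hfy : f y ∈ endMap f Q := ⟨y, hy, rfl⟩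
    let q : endMap f Q ⧸ U.subgroupOf (endMap f Q) := QuotientGroup.mk ⟨f y, hfy⟩
    have hz : (q.out : G)⁻¹ * f y ∈ U := by
      have h := QuotientGroup.eq.1 (QuotientGroup.out_eq' q)
      exact h
    have hzQ : (q.out : G)⁻¹ * f y ∈ Q := by
      have h1 : (q.out : G)⁻¹ * f y ∈ endMap f Q := mul_mem (inv_mem q.out.2) hfy
      have h2 : endMap f Q ≤ ⨆ n : ℕ, endComap (f ^ n) (stayForever f U) := by
        rintro _ ⟨x, hx, rfl⟩
        obtain ⟨_, n, hn⟩ := (hQ x).1 hx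
        refine mem_iSup_comap_stayForever.2 ⟨n, ?_⟩
        have h := apply_mem_stayForever hn
        rw [← pow_succ_apply, pow_succ_apply'] at h
        exact h
      exact ⟨map_backward_inf_le ⟨endMap_mono inf_le_left h1, hz⟩, h2 h1⟩
    -- Split `f(y)` as its representative times an element of `Q`; since `n ≥ N`, `f^n` sends the
    -- representative into `stayForever f U`.
    refine ⟨(f ^ n) (q.out : G), ?_, _, hzQ, ?_⟩
    · exact monotone_comap_stayForever ((hN (Set.mem_range_self q)).trans hn) (hg q)
    · rw [← map_mul, mul_inv_cancel_left, pow_succ_apply']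
  have hind : ∀ k, ∀ y ∈ Q, ∃ v ∈ stayForever f U, ∃ z ∈ Q,
      (f ^ (N + k)) y = v * (f ^ N) z := by
    intro k
    induction k with
    | zero => exact fun y hy => ⟨1, one_mem _, y, hy, by simp⟩
    | succ k ih =>
      intro y hy
      obtain ⟨v, hv, z, hz, h⟩ := hstep (N + k) (Nat.le_add_right N k) y hy
      obtain ⟨v', hv', z', hz', h'⟩ := ih z hz
      exact ⟨v * v', mul_mem hv hv', z', hz', by rw [← add_assoc, h, h', mul_assoc]⟩
  have hmono : ∀ k, Q ≤ endMap (f ^ k) Q := fun k => by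
    induction k with
    | zero => rw [pow_zero, endMap_one]
    | succ k ih =>
      rw [pow_succ', endMap_mul]
      exact hfQ.trans (endMap_mono ih)
  refine ⟨N, fun x hx => ?_⟩
  obtain ⟨⟨n, y, hy, rfl⟩, m, hm⟩ := (mem_homoclinic hb).1 hx
  have hyQ : y ∈ Q := (hQ y).2 ⟨hy, m + n, by rwa [pow_add_apply]⟩
  -- Going back `N` further steps gives `x = f^(N+n)(y')`, which `hind` reduces to exponent `N`.
  obtain ⟨y', hy', rfl⟩ := mem_endMap.1 (hmono N hyQ)
  obtain ⟨v, hv, z, hz, h⟩ := hind n y' hy'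
  refine ⟨v, stayForever_le hv, z, backward_le hz.1, ?_⟩
  rw [← h, ← pow_add_apply, add_comm]

theorem isCompact_closure_homoclinic (hf : Continuous f) (hUc : IsCompact (U : Set G))
    (hU : IsOpen (U : Set G)) : IsCompact ((homoclinic f U).topologicalClosure : Set G) := by
  obtain ⟨N, hN⟩ := exists_homoclinic_subset hf hUc hU
  have hC : IsCompact ((fun p : G × G => p.1 * (f ^ N) p.2) '' ((U : Set G) ×ˢ (U : Set G))) := by
    refine (hUc.prod hUc).image ?_
    have := continuous_pow hf N
    fun_prop
  refine hC.closure_of_subset fun x hx => ?_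
  obtain ⟨v, hv, y, hy, rfl⟩ := hN x hx
  exact ⟨(v, y), ⟨hv, hy⟩, rfl⟩

theorem apply_mem_closure_homoclinic (hf : Continuous f) (hUc : IsCompact (U : Set G))
    (hU : IsOpen (U : Set G)) {x : G} (hx : x ∈ (homoclinic f U).topologicalClosure) :
    f x ∈ (homoclinic f U).topologicalClosure :=
  map_mem_closure hf hx fun y hy => map_homoclinic_le (backward_le_endMap hf hUc hU) ⟨y, hy, rfl⟩

/-- A number bounding all displacement indices of `f` from below also bounds the growth of the
displacement indices of the powers of `f`. -/
theorem exists_forall_pow_le_relIndex (hf : Continuous f)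
    (hex : ∃ U : Subgroup G, IsCompact (U : Set G) ∧ IsOpen (U : Set G)) {s : ℕ}
    (hs : ∀ W : Subgroup G, IsCompact (W : Set G) → IsOpen (W : Set G) →
      s ≤ W.relIndex (endMap f W)) :
    ∃ V : Subgroup G, IsCompact (V : Set G) ∧ IsOpen (V : Set G) ∧
      ∀ n, s ^ n ≤ V.relIndex (endMap (f ^ n) V) := by
  obtain ⟨U, hUc, hU⟩ := hex
  -- `L` is formed from the large `U` before `V` is chosen, avoiding circularity; by monotonicity it
  -- still contains the homoclinic group of the smaller `V`.
  let L := (homoclinic f U).topologicalClosure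
  have hLc : IsCompact (L : Set G) := isCompact_closure_homoclinic hf hUc hU
  have hfL : ∀ n, ∀ x ∈ L, (f ^ n) x ∈ L := fun n x hx => by
    induction n with
    | zero => exact hx
    | succ n ih => rw [pow_succ_apply]; exact apply_mem_closure_homoclinic hf hUc hU ih
  obtain ⟨V₀, hV₀U, hV₀, hLV₀⟩ := exists_isOpen_le_forall_conj_mem hU hLc
  have hV₀c := isCompact_of_le hUc hV₀U hV₀
  obtain ⟨N, ht⟩ := exists_tidyAbove_stay hf hV₀c hV₀
  let V := stay f V₀ N
  have hV : IsOpen (V : Set G) := isOpen_stay hf hV₀ N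
  have hVc : IsCompact (V : Set G) := isCompact_stay hf hV₀c hV₀ N
  have hLV : L ≤ Subgroup.normalizer V := by
    refine Subgroup.le_normalizer_iff.2 fun l hl x hx => mem_stay.2 fun k hk => ?_
    simpa using hLV₀ _ (hfL k l hl) _ (mem_stay.1 hx k hk)
  let M := L ⊔ V
  have hMcoe : (M : Set G) = (L : Set G) * (V : Set G) := Subgroup.coe_mul_of_left_le_normalizer_right L V hLV
  have hMc : IsCompact (M : Set G) := by
    rw [hMcoe]
    exact hLc.mul hVc
  have hM : IsOpen (M : Set G) := Subgroup.isOpen_mono le_sup_right hV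
  refine ⟨V, hVc, hV, fun n => ?_⟩
  have hLM : L ≤ stay f M n := fun l hl =>
    mem_stay.2 fun k _ => (le_sup_left : L ≤ M) (hfL k l hl)
  have hVM : V ⊓ endComap (f ^ n) V ≤ stay f M n := by
    rintro x ⟨hx, hxn⟩
    obtain ⟨l, hl, hxl⟩ := TidyAbove.exists_homoclinic_mul_inv_mem_stay hf hVc hV ht hx hxn
    have hlL : l ∈ L := Subgroup.le_topologicalClosure _ (homoclinic_mono (stay_le.trans hV₀U) hl)
    rw [← inv_mul_cancel_right x l]
    exact mul_mem (stay_mono le_sup_right hxl) (hLM hlL)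
  have hne : (stay f M n).relIndex V ≠ 0 :=
    relIndex_ne_zero_of_isOpen_of_isCompact (isOpen_stay hf hM n) hVc
  calc s ^ n ≤ (stay f M n).relIndex M := pow_le_relIndex_stay
        (fun k => hs _ (isCompact_stay hf hMc hM k) (isOpen_stay hf hM k)) n
    _ ≤ (stay f M n).relIndex V := by
        -- As `M = LV` and `L ≤ stay f M n`, every coset of `stay f M n` in `M` has a representative
        -- in `V`.
        refine relIndex_le_of_forall_exists le_sup_right hne fun m hm => ?_
        have hm' : m⁻¹ ∈ (M : Set G) := inv_mem hm
        rw [hMcoe] at hm'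
        obtain ⟨l, hl, v, hv, hlv⟩ := hm'
        refine ⟨v⁻¹, inv_mem hv, ?_⟩
        have : v⁻¹⁻¹ * m = l⁻¹ := by
          rw [← inv_inv m, ← hlv]
          simp
        rw [this]
        exact inv_mem (hLM hl)
    _ ≤ (V ⊓ endComap (f ^ n) V).relIndex V := by
        refine Subgroup.relIndex_le_of_le_left hVM ?_
        rw [Subgroup.inf_relIndex_left, relIndex_endComap]
        exact relIndex_ne_zero_of_isOpen_of_isCompact hV
          (isCompact_endMap (continuous_pow hf n) hVc)
    _ = V.relIndex (endMap (f ^ n) V) := by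
        rw [Subgroup.inf_relIndex_left, relIndex_endComap]

end Topology

/-! ### The scale as a growth rate -/

section Scale

variable {G : Type*} [Group G] [TopologicalSpace G]

theorem displacementIndex_eq (α : ContEnd G) (U : Subgroup G) :
    displacementIndex α U = U.relIndex (endMap α U) :=
  Subgroup.inf_relIndex_left _ _

theorem scale_le (α : ContEnd G) {U : Subgroup G} (hUc : IsCompact (U : Set G))
    (hU : IsOpen (U : Set G)) : scale α ≤ U.relIndex (endMap α U) :=
  Nat.sInf_le ⟨U, hUc, hU, (displacementIndex_eq α U).symm⟩

variable [IsTopologicalGroup G]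

theorem relIndex_endMap_ne_zero {g : Monoid.End G} (hg : Continuous g) {U : Subgroup G}
    (hUc : IsCompact (U : Set G)) (hU : IsOpen (U : Set G)) : U.relIndex (endMap g U) ≠ 0 :=
  relIndex_ne_zero_of_isOpen_of_isCompact hU (isCompact_endMap hg hUc)

/-- With `A = h(U)` and `B = g(U ∩ A)`, use the chain `U ∩ B ≤ B ≤ g(A)`: the lower index is at most
that of `g`, the upper at most that of `h`. -/
theorem relIndex_endMap_mul_le {g h : Monoid.End G} (hg : Continuous g) (hh : Continuous h)
    {U : Subgroup G} (hUc : IsCompact (U : Set G)) (hU : IsOpen (U : Set G)) :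
    U.relIndex (endMap (g * h) U) ≤ U.relIndex (endMap g U) * U.relIndex (endMap h U) := by
  have hg0 := relIndex_endMap_ne_zero hg hUc hU
  have hh0 : (U ⊓ endMap h U).relIndex (endMap h U) ≠ 0 := by
    rw [Subgroup.inf_relIndex_right]
    exact relIndex_endMap_ne_zero hh hUc hU
  set A := endMap h U
  set B := endMap g (U ⊓ A)
  have hBU : B ≤ endMap g U := endMap_mono inf_le_left
  have hUB : U.relIndex B ≤ U.relIndex (endMap g U) := Subgroup.relIndex_le_of_le_right hBU hg0
  have hBA : B.relIndex (endMap g A) ≤ U.relIndex A :=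
    (relIndex_endMap_endMap_le hh0).trans_eq (Subgroup.inf_relIndex_right _ _)
  have hUA : U.relIndex (endMap g A) ≠ 0 :=
    relIndex_ne_zero_of_isOpen_of_isCompact hU (isCompact_endMap hg (isCompact_endMap hh hUc))
  have heq : (U ⊓ B).relIndex (endMap g A) = U.relIndex B * B.relIndex (endMap g A) := by
    rw [← Subgroup.relIndex_mul_relIndex _ _ _ inf_le_right (endMap_mono inf_le_right),
      Subgroup.inf_relIndex_right]
  -- An infinite index would read as `0`, so monotonicity of the index needs finiteness first.
  have hne : (U ⊓ B).relIndex (endMap g A) ≠ 0 := by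
    rw [heq]
    refine mul_ne_zero (fun h0 => hg0 (Subgroup.relIndex_eq_zero_of_le_right hBU h0)) ?_
    rw [← relIndex_endComap]
    refine fun h0 => hh0 (Subgroup.relIndex_eq_zero_of_le_left ?_ h0)
    exact fun x hx => mem_endComap.2 (mem_endMap.2 ⟨x, hx, rfl⟩)
  rw [endMap_mul]
  exact (Subgroup.relIndex_le_of_le_left inf_le_left hne).trans
    (heq.trans_le (Nat.mul_le_mul hUB hBA))

theorem relIndex_endMap_pow_le {f : Monoid.End G} (hf : Continuous f) {U : Subgroup G}
    (hUc : IsCompact (U : Set G)) (hU : IsOpen (U : Set G)) (n : ℕ) :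
    U.relIndex (endMap (f ^ n) U) ≤ U.relIndex (endMap f U) ^ n := by
  induction n with
  | zero => simp [endMap_one]
  | succ n ih =>
    rw [pow_succ', pow_succ']
    exact (relIndex_endMap_mul_le hf (continuous_pow hf n) hUc hU).trans
      (Nat.mul_le_mul_left _ ih)

/-- The displacement indices with respect to two compact open subgroups differ by at most a
constant factor, which does not depend on the endomorphism. -/
theorem relIndex_endMap_le {g : Monoid.End G} (hg : Continuous g) {U V : Subgroup G}
    (hUc : IsCompact (U : Set G)) (hU : IsOpen (U : Set G)) (hVc : IsCompact (V : Set G))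
    (hV : IsOpen (V : Set G)) :
    U.relIndex (endMap g U) ≤ V.relIndex U * U.relIndex V * V.relIndex (endMap g V) := by
  set W := U ⊓ V
  have hW : IsOpen (W : Set G) := hU.inter hV
  have hWU : W.relIndex U = V.relIndex U := Subgroup.inf_relIndex_left _ _
  have hWV : W.relIndex V = U.relIndex V := Subgroup.inf_relIndex_right _ _
  have hWU0 : W.relIndex U ≠ 0 := relIndex_ne_zero_of_isOpen_of_isCompact hW hUc
  have hWV0 : W.relIndex V ≠ 0 := relIndex_ne_zero_of_isOpen_of_isCompact hW hVc
  have hWgV : W.relIndex (endMap g V) ≠ 0 :=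
    relIndex_ne_zero_of_isOpen_of_isCompact hW (isCompact_endMap hg hVc)
  have h1 : W.relIndex (endMap g W) ≤ U.relIndex V * V.relIndex (endMap g V) := by
    -- Refine from `V` to `W` inside `g(V)`; this costs at most `[V : W]`.
    have h2 := Subgroup.relIndex_inf_mul_relIndex W V (endMap g V)
    rw [inf_eq_left.2 (inf_le_right : W ≤ V)] at h2
    refine (Subgroup.relIndex_le_of_le_right (endMap_mono inf_le_right) hWgV).trans ?_
    rw [← h2, ← hWV]
    exact Nat.mul_le_mul_right _ (Subgroup.relIndex_le_of_le_right inf_le_left hWV0)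
  have hWgW : W.relIndex (endMap g W) ≠ 0 :=
    relIndex_endMap_ne_zero hg (isCompact_of_le hUc inf_le_left hW) hW
  have heq : (W ⊓ endMap g W).relIndex (endMap g U) =
      W.relIndex (endMap g W) * (endMap g W).relIndex (endMap g U) := by
    rw [← Subgroup.relIndex_mul_relIndex _ _ _ inf_le_right (endMap_mono inf_le_left),
      Subgroup.inf_relIndex_right]
  have hne : (W ⊓ endMap g W).relIndex (endMap g U) ≠ 0 := by
    rw [heq]
    refine mul_ne_zero hWgW ?_
    rw [← relIndex_endComap]
    refine fun h0 => hWU0 (Subgroup.relIndex_eq_zero_of_le_left ?_ h0)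
    exact fun x hx => mem_endComap.2 (mem_endMap.2 ⟨x, hx, rfl⟩)
  calc U.relIndex (endMap g U) ≤ (W ⊓ endMap g W).relIndex (endMap g U) :=
        Subgroup.relIndex_le_of_le_left (inf_le_left.trans inf_le_left) hne
    _ ≤ (U.relIndex V * V.relIndex (endMap g V)) * V.relIndex U := by
        rw [heq, ← hWU]
        exact Nat.mul_le_mul h1 (relIndex_endMap_endMap_le hWU0)
    _ = _ := by ring

theorem le_of_forall_pow_le_mul_pow {a b C : ℕ} (h : ∀ n, a ^ n ≤ C * b ^ n) : a ≤ b := by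
  by_contra! hab
  rcases Nat.eq_zero_or_pos b with rfl | hb
  · have := h 1
    simp at this
    omega
  have hb' : (0 : ℝ) < b := by exact_mod_cast hb
  obtain ⟨n, hn⟩ := pow_unbounded_of_one_lt (C : ℝ)
    ((one_lt_div hb').2 (by exact_mod_cast hab : (b : ℝ) < a))
  rw [div_pow, lt_div_iff₀ (pow_pos hb' n)] at hn
  exact absurd (h n) (not_le.2 (by exact_mod_cast hn))

variable [LocallyCompactSpace G] [TotallyDisconnectedSpace G]

theorem exists_relIndex_eq_scale (α : ContEnd G) :
    ∃ U : Subgroup G, IsCompact (U : Set G) ∧ IsOpen (U : Set G) ∧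
      U.relIndex (endMap α U) = scale α := by
  obtain ⟨U, hUc, hU⟩ := exists_isCompact_isOpen_subgroup (G := G)
  obtain ⟨V, hVc, hV, h⟩ := Nat.sInf_mem (s := {m : ℕ | ∃ U : Subgroup G,
    IsCompact (U : Set G) ∧ IsOpen (U : Set G) ∧ m = displacementIndex α U}) ⟨_, U, hUc, hU, rfl⟩
  exact ⟨V, hVc, hV, (displacementIndex_eq α V).symm.trans h.symm⟩

theorem exists_scale_pow_le (α : ContEnd G) :
    ∃ V : Subgroup G, IsCompact (V : Set G) ∧ IsOpen (V : Set G) ∧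
      ∀ n, scale α ^ n ≤ V.relIndex (endMap ((α : Monoid.End G) ^ n) V) :=
  exists_forall_pow_le_relIndex α.2 exists_isCompact_isOpen_subgroup fun _ => scale_le α

/-- Both sides are growth rates in `n` of the displacement indices of `α^(k*n)`. Each inequality
sets a lower bound at one subgroup against an upper bound at another, the change of subgroup being
the constant `C`. -/
theorem scale_pow (α : ContEnd G) (k : ℕ) : scale (α ^ k) = scale α ^ k := by
  obtain ⟨U, hUc, hU, hUs⟩ := exists_relIndex_eq_scale α
  obtain ⟨V, hVc, hV, hVs⟩ := exists_scale_pow_le α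
  obtain ⟨U', hUc', hU', hUs'⟩ := exists_relIndex_eq_scale (α ^ k)
  obtain ⟨V', hVc', hV', hVs'⟩ := exists_scale_pow_le (α ^ k)
  rw [SubmonoidClass.coe_pow] at hUs' hVs'
  apply le_antisymm
  · refine le_of_forall_pow_le_mul_pow (C := U.relIndex V' * V'.relIndex U) fun n => ?_
    refine (hVs' n).trans ?_
    rw [← pow_mul, ← pow_mul]
    refine (relIndex_endMap_le (continuous_pow α.2 _) hVc' hV' hUc hU).trans ?_
    rw [← hUs]
    exact Nat.mul_le_mul_left _ (relIndex_endMap_pow_le α.2 hUc hU _)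
  · refine le_of_forall_pow_le_mul_pow (C := U'.relIndex V * V.relIndex U') fun n => ?_
    rw [← pow_mul]
    refine (hVs (k * n)).trans ?_
    refine (relIndex_endMap_le (continuous_pow α.2 _) hVc hV hUc' hU').trans ?_
    rw [← hUs', pow_mul]
    exact Nat.mul_le_mul_left _ (relIndex_endMap_pow_le (continuous_pow α.2 k) hUc' hU' n)

theorem scale_pos (α : ContEnd G) : 0 < scale α := by
  obtain ⟨U, hUc, hU, hUs⟩ := exists_relIndex_eq_scale α
  rw [← hUs]
  exact Nat.pos_of_ne_zero (relIndex_endMap_ne_zero α.2 hUc hU)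

theorem scale_eq_one_iff (α : ContEnd G) : scale α = 1 ↔
    ∃ U : Subgroup G, IsCompact (U : Set G) ∧ IsOpen (U : Set G) ∧ imageSubgroup α U ≤ U := by
  constructor
  · intro h
    obtain ⟨U, hUc, hU, hUs⟩ := exists_relIndex_eq_scale α
    exact ⟨U, hUc, hU, Subgroup.relIndex_eq_one.1 (hUs.trans h)⟩
  · rintro ⟨U, hUc, hU, h⟩
    exact le_antisymm ((scale_le α hUc hU).trans_eq (Subgroup.relIndex_eq_one.2 h)) (scale_pos α)

end Scale

end EndScale

theorem mainTheorem3 {G : Type*} [Group G] [TopologicalSpace G] [IsTopologicalGroup G]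
    [LocallyCompactSpace G] [TotallyDisconnectedSpace G] :
    (∀ α : ContEnd G, 0 < scale α) ∧
    (∀ α : ContEnd G, scale α = 1 ↔
      ∃ U : Subgroup G, IsCompact (U : Set G) ∧ IsOpen (U : Set G) ∧ imageSubgroup α U ≤ U) ∧
    (∀ (α : ContEnd G) (n : ℕ), scale (α ^ n) = scale α ^ n) :=
  ⟨EndScale.scale_pos, EndScale.scale_eq_one_iff, EndScale.scale_pow⟩
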